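/- Let $\mathfrak c$ be the cardinality of the continuum. Assume $\mathsf{MA(countable)}$, Martin's Axiom for countable posets: for every non-empty countable partially ordered set $P$ and every collection of fewer than $\mathfrak c$ dense subsets of $P$ (where $D\subseteq P$ is dense if every $p\in P$ has some $q\in D$ with $q\le p$), there is a filter on $P$ (a non-empty, upward closed, downward directed subset) that meets every member of the collection. Let $X$ be a Polish space (possibly with isolated points), and let $\mathcal R$ be a collection of relations on $X$ with $|\mathcal R|<\mathfrak c$, where a relation on $X$ is a subset $R\subseteq X^{n}$ for some integer $n=n_R\ge 1$; assume that every $R\in\mathcal R$ is meager, i.e. a meager subset of $X^{n_R}$ with the product topology. Then there exists $F\subseteq X$ such that - $F$ is dense in $X$; - $F$ is completely Baire, i.e. every closed subspace of the space $F$ is a Baire space; - $F$ is $\mathcal R$-free, i.e. for every $R\in\mathcal R$ and all pairwise distinct $x_0,\dots,x_{n_R-1}\in F$ we have $(x_0,\dots,x_{n_R-1})\notin R$. -/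

import Mathlib

/-- Martin's Axiom for countable posets: for every non-empty countable poset `P` and every
collection of fewer than continuum many dense subsets of `P` there is a filter on `P` that meets
all of them. Smaller elements are the stronger conditions, so that `D` is dense when every
element of `P` has an element of `D` below it. -/
def MACountable : Prop :=
  ∀ (P : Type) [PartialOrder P] [Countable P] [Nonempty P] (𝒟 : Set (Set P)),
    Cardinal.mk 𝒟 < Cardinal.continuum →
    (∀ D ∈ 𝒟, ∀ p : P, ∃ q ∈ D, q ≤ p) →
    ∃ G : Order.PFilter P, ∀ D ∈ 𝒟, ∃ p ∈ D, p ∈ G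

/-- A relation on a set `X`: a subset of `X ^ n` for some finite `n ≥ 1`, its arity. -/
structure FinitaryRelation (X : Type*) where
  arity : ℕ
  one_le_arity : 1 ≤ arity
  carrier : Set (Fin arity → X)

/-- A relation on a space `X` is meager if it is a meager subset of `X ^ n` (with the product
topology), where `n` is its arity. -/
def FinitaryRelation.IsMeager {X : Type*} [TopologicalSpace X] (R : FinitaryRelation X) : Prop :=
  IsMeagre R.carrier

/-- `F` is `R`-free: no injective tuple of elements of `F` belongs to `R`. -/
def FinitaryRelation.IsFree {X : Type*} (R : FinitaryRelation X) (F : Set X) : Prop :=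
  ∀ x : Fin R.arity → X, (∀ i, x i ∈ F) → Function.Injective x → x ∉ R.carrier

/-- A space is completely Baire if each of its closed subspaces is a Baire space. -/
def IsCompletelyBaire (X : Type*) [TopologicalSpace X] : Prop :=
  ∀ A : Set X, IsClosed A → BaireSpace A

/-! Each meager relation is covered by countably many closed nowhere dense ones, so the relations
may be taken closed and nowhere dense. `MACountable` says that fewer than `𝔠` dense open subsets of
a non-empty Polish space have a common point. In `X ^ ℕ` this yields a generic sequence whose range
is a countable dense free set `F₀`.

To be completely Baire, it suffices that `F` meets `closure K ∩ ⋂ n, U n` whenever `K ⊆ F` is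
countable, non-empty and crowded and the open sets `U n` are dense on `K`
(`isCompletelyBaire_of_crowded`). There are at most `𝔠` such tasks. One task can be met over any
free `F ⊇ K` of size less than `𝔠` (`MACountable.exists_isFreeFor_insert`): a closed relation
excludes an open set of new points, and this set is dense in `closure K` because all but finitely
many points of `K` are already known to be allowed, `F` being free. A recursion over the tasks
(`exists_free_superset`) meets them all, starting from `F₀`. -/

open Set Topology Cardinal TopologicalSpace
universe u

/-! ### Martin's Axiom as a category statement -/

/-- Formal balls with centers in a fixed sequence and dyadic radii: the ball of radius
`2⁻ᵉˣᵖᵒⁿᵉⁿᵗ` around `d index`. -/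
@[ext] structure DyadicBall {Y : Type*} (d : ℕ → Y) : Type where
  index : ℕ
  exponent : ℕ

namespace DyadicBall

variable {Y : Type*}

instance (d : ℕ → Y) : Countable (DyadicBall d) :=
  Function.Injective.countable (f := fun p : DyadicBall d => (p.index, p.exponent))
    fun p q h => by simpa [DyadicBall.ext_iff] using h

instance (d : ℕ → Y) : Nonempty (DyadicBall d) := ⟨⟨0, 0⟩⟩

/-- The center of a formal ball. -/
def center {d : ℕ → Y} (p : DyadicBall d) : Y := d p.index

/-- The radius of a formal ball. -/
noncomputable def radius {d : ℕ → Y} (p : DyadicBall d) : ℝ := (1 / 2 : ℝ) ^ p.exponent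

theorem radius_pos {d : ℕ → Y} (p : DyadicBall d) : 0 < p.radius := by
  unfold radius; positivity

instance [MetricSpace Y] (d : ℕ → Y) : PartialOrder (DyadicBall d) where
  -- The exponent clause follows from the inequality of radii; it makes irreflexivity and asymmetry
  -- immediate.
  le p q := p = q ∨ q.exponent < p.exponent ∧ dist p.center q.center + p.radius < q.radius
  lt p q := q.exponent < p.exponent ∧ dist p.center q.center + p.radius < q.radius
  lt_iff_le_not_ge p q := by
    constructor
    · refine fun h => ⟨Or.inr h, ?_⟩
      rintro (rfl | ⟨h', -⟩)
      · exact lt_irrefl _ h.1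
      · exact lt_asymm h.1 h'
    · rintro ⟨rfl | h, h'⟩
      · exact absurd (Or.inl rfl) h'
      · exact h
  le_refl p := Or.inl rfl
  le_trans p q r := by
    rintro (rfl | ⟨h1, h2⟩) (rfl | ⟨h3, h4⟩)
    · exact Or.inl rfl
    · exact Or.inr ⟨h3, h4⟩
    · exact Or.inr ⟨h1, h2⟩
    · exact Or.inr ⟨h3.trans h1, by linarith [dist_triangle p.center q.center r.center]⟩
  le_antisymm p q := by
    rintro (h | ⟨h1, -⟩) (h' | ⟨h3, -⟩)
    · exact h
    · exact h
    · exact h'.symm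
    · exact absurd h3 (lt_asymm h1)

theorem dist_center_le [MetricSpace Y] {d : ℕ → Y} {p q : DyadicBall d} (h : p ≤ q) :
    dist p.center q.center ≤ q.radius := by
  rcases h with rfl | ⟨-, h⟩
  · simpa using p.radius_pos.le
  · linarith [p.radius_pos]

/-- Every formal ball has arbitrarily small refinements inside a given dense open set. -/
theorem exists_le [MetricSpace Y] {d : ℕ → Y} (hd : DenseRange d) (p : DyadicBall d) (m : ℕ)
    {V : Set Y} (hV : IsOpen V) (hVd : Dense V) :
    ∃ q : DyadicBall d, m ≤ q.exponent ∧ Metric.closedBall q.center q.radius ⊆ V ∧ q ≤ p := by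
  have hpow : Filter.Tendsto (fun k : ℕ => (1 / 2 : ℝ) ^ k) Filter.atTop (𝓝 0) :=
    tendsto_pow_atTop_nhds_zero_of_lt_one (by norm_num) (by norm_num)
  obtain ⟨n, hnV, hnb⟩ : ∃ n, d n ∈ V ∧ d n ∈ Metric.ball p.center p.radius := by
    obtain ⟨z, hz1, hz2⟩ := hVd.inter_open_nonempty _ Metric.isOpen_ball
      ⟨p.center, Metric.mem_ball_self p.radius_pos⟩
    exact hd.exists_mem_open (hV.inter Metric.isOpen_ball) ⟨z, hz2, hz1⟩
  obtain ⟨ε, hε, hεV⟩ := Metric.isOpen_iff.1 hV _ hnV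
  have hδ : 0 < p.radius - dist (d n) p.center := sub_pos.2 hnb
  obtain ⟨k, hk1, hk2, hk3⟩ := ((hpow.eventually (gt_mem_nhds hε)).and
    ((hpow.eventually (gt_mem_nhds hδ)).and
      (Filter.eventually_ge_atTop (max m (p.exponent + 1))))).exists
  refine ⟨⟨n, k⟩, (le_max_left _ _).trans hk3,
    (Metric.closedBall_subset_ball hk1).trans hεV, Or.inr ⟨(le_max_right _ _).trans hk3, ?_⟩⟩
  change dist (d n) p.center + (1 / 2 : ℝ) ^ k < p.radius
  linarith

end DyadicBall

/-- Under Martin's Axiom for countable posets, fewer than continuum many dense open subsets of a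
non-empty Polish space have a common point. -/
theorem MACountable.exists_mem_of_dense_open (hMA : MACountable) {Y : Type*} [TopologicalSpace Y]
    [PolishSpace Y] [Nonempty Y] {ι : Type*} (U : ι → Set Y) (hι : #ι < 𝔠)
    (ho : ∀ i, IsOpen (U i)) (hd : ∀ i, Dense (U i)) : ∃ y, ∀ i, y ∈ U i := by
  let := upgradeIsCompletelyMetrizable Y
  -- Balls are coded by natural numbers, so the poset lies in `Type`, as `MACountable` requires,
  -- whatever the universe of `Y`.
  let d := denseSeq Y
  have hdr : DenseRange d := denseRange_denseSeq Y
  let E : ℕ → Set (DyadicBall d) := fun m => {p | m ≤ p.exponent}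
  let D : ι → Set (DyadicBall d) := fun i => {p | Metric.closedBall p.center p.radius ⊆ U i}
  have hpow : Filter.Tendsto (fun k : ℕ => (1 / 2 : ℝ) ^ k) Filter.atTop (𝓝 0) :=
    tendsto_pow_atTop_nhds_zero_of_lt_one (by norm_num) (by norm_num)
  have hcard : #(range E ∪ range D : Set (Set (DyadicBall d))) < 𝔠 := by
    refine (mk_union_le _ _).trans_lt (add_lt_of_lt aleph0_le_continuum ?_ ?_)
    · exact ((countable_range E).le_aleph0).trans_lt aleph0_lt_continuum
    · rw [← lift_lt_continuum]
      exact mk_range_le_lift.trans_lt (lift_lt_continuum.2 hι)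
  obtain ⟨G, hG⟩ := hMA (DyadicBall d) (range E ∪ range D) hcard (by
    rintro _ (⟨m, rfl⟩ | ⟨i, rfl⟩) p
    · obtain ⟨q, h1, -, h3⟩ := p.exists_le hdr m isOpen_univ dense_univ
      exact ⟨q, h1, h3⟩
    · obtain ⟨q, -, h2, h3⟩ := p.exists_le hdr 0 (ho i) (hd i)
      exact ⟨q, h2, h3⟩)
  -- Two balls of the filter have a common refinement, whose center is near both; hence the centers
  -- of shrinking balls form a Cauchy sequence.
  have hdist : ∀ p ∈ G, ∀ q ∈ G, dist p.center q.center ≤ p.radius + q.radius := by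
    intro p hp q hq
    obtain ⟨r, -, hrp, hrq⟩ := G.directed p hp q hq
    linarith [dist_triangle_left p.center q.center r.center, DyadicBall.dist_center_le hrp,
      DyadicBall.dist_center_le hrq]
  choose g hg hgG using fun m => hG (E m) (Or.inl ⟨m, rfl⟩)
  have hgm : ∀ m, (g m).radius ≤ (1 / 2 : ℝ) ^ m := fun m =>
    pow_le_pow_of_le_one (by norm_num) (by norm_num) (hg m)
  have hcau : CauchySeq fun m => (g m).center := by
    refine cauchySeq_of_le_tendsto_0 (fun m => (1 / 2 : ℝ) ^ m + (1 / 2 : ℝ) ^ m) ?_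
      (by simpa using hpow.add hpow)
    intro a b N ha hb
    have h1 : (1 / 2 : ℝ) ^ a ≤ (1 / 2 : ℝ) ^ N :=
      pow_le_pow_of_le_one (by norm_num) (by norm_num) ha
    have h2 : (1 / 2 : ℝ) ^ b ≤ (1 / 2 : ℝ) ^ N :=
      pow_le_pow_of_le_one (by norm_num) (by norm_num) hb
    linarith [hdist _ (hgG a) _ (hgG b), hgm a, hgm b]
  obtain ⟨y, hy⟩ := cauchySeq_tendsto_of_complete hcau
  refine ⟨y, fun i => ?_⟩
  obtain ⟨p, hpD, hpG⟩ := hG (D i) (Or.inr ⟨i, rfl⟩)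
  refine hpD (Metric.mem_closedBall.2 ?_)
  have hlim : Filter.Tendsto (fun m : ℕ => (1 / 2 : ℝ) ^ m + p.radius) Filter.atTop
      (𝓝 p.radius) := by simpa using hpow.add_const p.radius
  refine le_of_tendsto_of_tendsto' (hy.dist tendsto_const_nhds) hlim fun m => ?_
  linarith [hgm m, hdist _ (hgG m) _ hpG]

/-! ### Transfinite closing-off -/

/-- If a union of successive extensions of a free set `F₀` is built from free stages, then it is
free, for a notion of freeness that is of finite character. -/
theorem free_union_iUnion {W X : Type*} [LinearOrder W] {Free : Set X → Prop}
    (hfc : ∀ S, Free S ↔ ∀ t ⊆ S, t.Finite → Free t)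
    {F₀ : Set X} (h₀ : Free F₀) (A : W → Set X) (V : Set W)
    (hV : ∀ v ∈ V, Free (F₀ ∪ ⋃ u ∈ Iic v, A u)) : Free (F₀ ∪ ⋃ v ∈ V, A v) := by
  refine (hfc _).2 fun t ht hfin => ?_
  have key : t ⊆ F₀ ∨ ∃ v ∈ V, t ⊆ F₀ ∪ ⋃ u ∈ Iic v, A u := by
    induction t, hfin using Set.Finite.induction_on with
    | empty => exact Or.inl (empty_subset _)
    | @insert a s _ _ ih =>
      obtain ⟨ha, hs⟩ := insert_subset_iff.1 ht
      have mono : ∀ {v w : W}, v ≤ w → (F₀ ∪ ⋃ u ∈ Iic v, A u) ⊆ F₀ ∪ ⋃ u ∈ Iic w, A u :=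
        fun h => union_subset_union_right _ (biUnion_subset_biUnion_left (Iic_subset_Iic.2 h))
      have mem : ∀ {v : W}, a ∈ A v → a ∈ F₀ ∪ ⋃ u ∈ Iic v, A u :=
        fun h => Or.inr (mem_biUnion (mem_Iic.2 le_rfl) h)
      rcases ha with ha | ha
      · rcases ih hs with h | ⟨v, hv, h⟩
        · exact Or.inl (insert_subset ha h)
        · exact Or.inr ⟨v, hv, insert_subset (Or.inl ha) h⟩
      · obtain ⟨v, hv, hav⟩ := mem_iUnion₂.1 ha
        rcases ih hs with h | ⟨w, hw, h⟩
        · exact Or.inr ⟨v, hv, insert_subset (mem hav) (h.trans subset_union_left)⟩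
        · rcases le_total v w with hvw | hvw
          · exact Or.inr ⟨w, hw, insert_subset (mono hvw (mem hav)) h⟩
          · exact Or.inr ⟨v, hv, insert_subset (mem hav) (h.trans (mono hvw))⟩
  rcases key with h | ⟨v, hv, h⟩
  · exact (hfc _).1 h₀ t h hfin
  · exact (hfc _).1 (hV v hv) t h hfin

/-- Closing off a countable free set under at most continuum many tasks. A task `w` asks for a
point of `T w` as soon as the countable set `K w` has been absorbed, and can be fulfilled over
every free set of cardinality less than the continuum. -/
theorem exists_free_superset {W X : Type u} {Free : Set X → Prop} (hW : #W ≤ 𝔠)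
    (hfc : ∀ S, Free S ↔ ∀ t ⊆ S, t.Finite → Free t)
    (K T : W → Set X) (hK : ∀ w, (K w).Countable)
    (hext : ∀ w F, Free F → #F < 𝔠 → K w ⊆ F → ∃ x ∈ T w, Free (insert x F))
    {F₀ : Set X} (h₀ : Free F₀) (hc₀ : F₀.Countable) :
    ∃ F, F₀ ⊆ F ∧ Free F ∧ ∀ w, K w ⊆ F → (F ∩ T w).Nonempty := by
  classical
  -- In a well-order of the least possible type, proper initial segments have fewer than `𝔠`
  -- elements.
  obtain ⟨_, _, hord⟩ := exists_ord_eq_type_lt W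
  have hmono : ∀ {S S' : Set X}, S ⊆ S' → Free S' → Free S := fun h h' =>
    (hfc _).2 fun t ht hfin => (hfc _).1 h' t (ht.trans h) hfin
  -- the set added at a stage, in terms of what has been built before
  let step : W → Set X → Set X := fun w G =>
    if h : ∃ x ∈ T w, Free (insert x (G ∪ K w)) then insert h.choose (K w) else ∅
  have hstep_free : ∀ w G, Free G → Free (G ∪ step w G) := by
    intro w G hG
    by_cases h : ∃ x ∈ T w, Free (insert x (G ∪ K w))
    · simpa [step, dif_pos h, union_insert] using h.choose_spec.2
    · simpa [step, dif_neg h] using hG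
  have hstep_count : ∀ w G, (step w G).Countable := by
    intro w G
    by_cases h : ∃ x ∈ T w, Free (insert x (G ∪ K w))
    · simpa only [step, dif_pos h] using (hK w).insert _
    · simp only [step, dif_neg h, countable_empty]
  let A : W → Set X := (wellFounded_lt (α := W)).fix
    fun w ih => step w (F₀ ∪ ⋃ v : Iio w, ih v v.2)
  have hA : ∀ w, A w = step w (F₀ ∪ ⋃ v ∈ Iio w, A v) := by
    intro w
    rw [biUnion_eq_iUnion]
    exact (wellFounded_lt (α := W)).fix_eq _ w
  have hIic : ∀ w, (⋃ v ∈ Iic w, A v) = (⋃ v ∈ Iio w, A v) ∪ A w := by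
    intro w
    rw [← Iio_insert, biUnion_insert, union_comm]
  have hfree : ∀ w, Free (F₀ ∪ ⋃ v ∈ Iic w, A v) := by
    intro w
    induction w using (wellFounded_lt (α := W)).induction with
    | _ w ih =>
      rw [hIic, ← union_assoc]
      have := hstep_free w _ (free_union_iUnion hfc h₀ A (Iio w) ih)
      rwa [← hA w] at this
  have hF : Free (F₀ ∪ ⋃ w ∈ Set.univ, A w) := free_union_iUnion hfc h₀ A _ fun w _ => hfree w
  refine ⟨_, subset_union_left, hF, fun w hw => ?_⟩
  have hGF : (F₀ ∪ ⋃ v ∈ Iio w, A v) ∪ K w ⊆ F₀ ∪ ⋃ w ∈ Set.univ, A w :=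
    union_subset (union_subset_union_right _ (biUnion_subset_biUnion_left (Set.subset_univ _))) hw
  have hlt : ∀ {S : Set X}, S.Countable → #S < 𝔠 := fun h =>
    h.le_aleph0.trans_lt aleph0_lt_continuum
  have hIio : #(⋃ v ∈ Iio w, A v : Set X) < 𝔠 := by
    rw [biUnion_eq_iUnion]
    -- Each stage adds only countably many points, so the bound is a product of two cardinals below
    -- `𝔠`; regularity of `𝔠` is not needed.
    refine (mk_iUnion_le_sum_mk).trans_lt ?_
    refine (sum_le_sum _ (fun _ => ℵ₀) fun v => ?_).trans_lt ?_
    · rw [hA]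
      exact (hstep_count _ _).le_aleph0
    · rw [sum_const']
      exact mul_lt_of_lt aleph0_le_continuum ((mk_Iio_lt w hord).trans_le hW) aleph0_lt_continuum
  have hcard : #((F₀ ∪ ⋃ v ∈ Iio w, A v) ∪ K w : Set X) < 𝔠 :=
    (mk_union_le _ _).trans_lt <| add_lt_of_lt aleph0_le_continuum
      ((mk_union_le _ _).trans_lt <| add_lt_of_lt aleph0_le_continuum (hlt hc₀) hIio) (hlt (hK w))
  have h := hext w _ (hmono hGF hF) hcard subset_union_right
  have hAw : A w = insert h.choose (K w) := by
    rw [hA]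
    exact dif_pos h
  refine ⟨h.choose, Or.inr (mem_biUnion (mem_univ w) ?_), h.choose_spec.1⟩
  rw [hAw]
  exact mem_insert _ _

/-! ### Free sets and generic points -/

section Free

variable {X ι : Type*}

/-- `F` is free for each relation of the family `C`. -/
def IsFreeFor (C : ι → FinitaryRelation X) (F : Set X) : Prop := ∀ i, (C i).IsFree F

theorem isFreeFor_iff_finite (C : ι → FinitaryRelation X) (S : Set X) :
    IsFreeFor C S ↔ ∀ t ⊆ S, t.Finite → IsFreeFor C t :=
  ⟨fun h _ ht _ i x hx => h i x fun j => ht (hx j), fun h i x hx hinj =>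
    h (range x) (range_subset_iff.2 hx) (finite_range x) i x (fun j => mem_range_self j) hinj⟩

/-- Adding a point to a free set `F` keeps it free, if no relation holds at an injective tuple one
of whose entries is the new point while the others are in `F`. -/
theorem IsFreeFor.insert {C : ι → FinitaryRelation X} {F : Set X} (hF : IsFreeFor C F) {x : X}
    (h : ∀ i (j : Fin (C i).arity) (a : Fin (C i).arity → X), (∀ k ≠ j, a k ∈ F) →
      InjOn a {j}ᶜ → Function.update a j x ∉ (C i).carrier) :
    IsFreeFor C (insert x F) := by
  intro i z hz hinj
  by_cases hx : ∃ j, z j = x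
  · obtain ⟨j, rfl⟩ := hx
    have := h i j z (fun k hk => (hz k).resolve_left fun he => hk (hinj he)) hinj.injOn
    rwa [Function.update_eq_self] at this
  · push Not at hx
    exact hF i z (fun k => (hz k).resolve_left (hx k)) hinj

end Free

/-- Under Martin's Axiom for countable posets, a free set `F` of cardinality less than the continuum
for fewer than continuum many closed relations extends by a point generic in the closure of a
crowded subset `K` of `F`. -/
theorem MACountable.exists_isFreeFor_insert (hMA : MACountable) {X ι : Type u} [TopologicalSpace X]
    [PolishSpace X] (hι : #ι < 𝔠) {C : ι → FinitaryRelation X}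
    (hC : ∀ i, IsClosed (C i).carrier) {F K : Set X} (hF : IsFreeFor C F) (hFc : #F < 𝔠)
    (hKF : K ⊆ F) (hK : K.Nonempty) (hcr : ∀ p, K ⊆ closure (K \ {p})) {U : ℕ → Set X}
    (hU : ∀ n, IsOpen (U n)) (hUK : ∀ n, K ⊆ closure (U n ∩ K)) :
    ∃ x ∈ closure K ∩ ⋂ n, U n, IsFreeFor C (insert x F) := by
  classical
  have : PolishSpace (closure K) := isClosed_closure.polishSpace
  have : Nonempty (closure K) := hK.closure.to_subtype
  obtain ⟨x₀, hx₀⟩ := hK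
  -- Removing finitely many points from a crowded set leaves a dense subset of it.
  have hfin : ∀ s : Finset X, K ⊆ closure (K \ s) := by
    intro s
    induction s using Finset.induction_on with
    | empty => simpa using subset_closure
    | insert a s _ ih =>
      intro q hq
      rw [mem_closure_iff]
      intro O hO hqO
      obtain ⟨r, hrO, hrK, hrs⟩ := mem_closure_iff.1 (ih hq) O hO hqO
      obtain ⟨r', ⟨hO', hs'⟩, hK', ha'⟩ := mem_closure_iff.1 (hcr a hrK) (O ∩ (↑s)ᶜ)
        (hO.inter s.finite_toSet.isClosed.isOpen_compl) ⟨hrO, hrs⟩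
      exact ⟨r', hO', hK', by simpa using ⟨ha', hs'⟩⟩
  have hdense : ∀ V : Set X, (∀ O, IsOpen O → (K ∩ O).Nonempty → (K ∩ O ∩ V).Nonempty) →
      Dense ((↑) ⁻¹' V : Set (closure K)) := by
    intro V hV y
    rw [mem_closure_iff]
    rintro _ ⟨O, hO, rfl⟩ hy
    obtain ⟨q, hqO, hqK⟩ := mem_closure_iff.1 y.2 O hO hy
    obtain ⟨r, ⟨hrK, hrO⟩, hrV⟩ := hV O hO ⟨q, hqK, hqO⟩
    exact ⟨⟨r, subset_closure hrK⟩, hrO, hrV⟩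
  -- A relation, a slot for the new point, and entries from `F` for the other slots. Tuples with
  -- repetitions off the slot impose no condition.
  let J := Σ i : ι, Fin (C i).arity × (Fin (C i).arity → F)
  let Good : J → Prop := fun j => InjOn (fun k => (j.2.2 k : X)) {j.2.1}ᶜ
  let V : ℕ ⊕ J → Set X := Sum.elim U fun j =>
    {y | Good j → Function.update (fun k => (j.2.2 k : X)) j.2.1 y ∉ (C j.1).carrier}
  have hJ : #J < 𝔠 := by
    have hinj : Function.Injective
        (fun j : J => ((j.1, (j.2.1 : ℕ), List.ofFn j.2.2) : ι × ℕ × List F)) := by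
      rintro ⟨i, k, a⟩ ⟨i', k', a'⟩ h
      simp only [Prod.mk.injEq] at h
      obtain ⟨rfl, hk, ha⟩ := h
      rw [Fin.ext hk, List.ofFn_injective ha]
    refine (mk_le_of_injective hinj).trans_lt ?_
    simp only [mk_prod, lift_id, lift_uzero, mk_nat, lift_aleph0]
    refine mul_lt_of_lt aleph0_le_continuum (by simpa using hι) ?_
    refine mul_lt_of_lt aleph0_le_continuum aleph0_lt_continuum ?_
    simpa using (mk_list_le_max F).trans_lt (max_lt aleph0_lt_continuum hFc)
  obtain ⟨x, hx⟩ := hMA.exists_mem_of_dense_open (Y := closure K)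
    (fun j : ℕ ⊕ J => (↑) ⁻¹' V j)
    (by
      rw [mk_sum]
      exact add_lt_of_lt aleph0_le_continuum (by simpa using aleph0_lt_continuum) (by simpa using hJ))
    (by
      rintro (n | ⟨i, k, a⟩)
      · exact (hU n).preimage continuous_subtype_val
      · refine IsOpen.preimage continuous_subtype_val ?_
        by_cases hg : Good ⟨i, k, a⟩
        · simp only [V, Sum.elim_inr, hg, forall_const]
          exact (hC i).isOpen_compl.preimage (continuous_const.update k continuous_id)
        · simp [V, hg])
    (by
      rintro (n | ⟨i, k, a⟩)
      · refine hdense _ ?_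
        rintro O hO ⟨q, hqK, hqO⟩
        obtain ⟨r, hrO, hrU, hrK⟩ := mem_closure_iff.1 (hUK n hqK) O hO hqO
        exact ⟨r, ⟨hrK, hrO⟩, hrU⟩
      · refine hdense _ ?_
        rintro O hO ⟨q, hqK, hqO⟩
        obtain ⟨r, hrO, hrK, hra⟩ := mem_closure_iff.1
          (hfin (Finset.univ.image fun l => (a l : X)) hqK) O hO hqO
        -- Since `r ∈ K ⊆ F` differs from every entry of `a`, the updated tuple is injective in `F`,
        -- so freeness of `F` applies.
        refine ⟨r, ⟨hrK, hrO⟩, fun hg => hF i _ ?_ ?_⟩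
        · intro l
          rcases eq_or_ne l k with rfl | hl
          · simpa using hKF hrK
          · simp [hl]
        · have hra' : ∀ l, (a l : X) ≠ r := by simpa using hra
          intro l m hlm
          rcases eq_or_ne k l with rfl | hl <;> rcases eq_or_ne k m with rfl | hm
          · rfl
          · simp only [Function.update_self, Function.update_of_ne hm.symm] at hlm
            exact absurd hlm.symm (hra' _)
          · simp only [Function.update_self, Function.update_of_ne hl.symm] at hlm
            exact absurd hlm (hra' _)
          · simp only [Function.update_of_ne hl.symm, Function.update_of_ne hm.symm] at hlm
            exact hg hl.symm hm.symm hlm)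
  refine ⟨x, ⟨x.2, mem_iInter.2 fun n => hx (Sum.inl n)⟩, hF.insert fun i j a ha hinj => ?_⟩
  -- The value `x₀` in slot `j` is arbitrary: the update overwrites it.
  let b : Fin (C i).arity → F := fun k => if h : k = j then ⟨x₀, hKF hx₀⟩ else ⟨a k, ha k h⟩
  have hb : ∀ k ≠ j, (b k : X) = a k := fun k hk => by simp [b, hk]
  have hgood : Good ⟨i, j, b⟩ := fun l hl m hm hlm => hinj hl hm (by
    simpa only [hb l hl, hb m hm] using hlm)
  have hup : Function.update a j (x : X) = Function.update (fun k => (b k : X)) j x := by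
    ext k
    rcases eq_or_ne k j with rfl | hk
    · simp
    · simp [hk, hb k hk]
  rw [hup]
  exact hx (Sum.inr ⟨i, j, b⟩) hgood

/-- Under Martin's Axiom for countable posets, fewer than continuum many closed nowhere dense
relations on a Polish space have a countable dense free set. -/
theorem MACountable.exists_countable_dense_isFreeFor (hMA : MACountable) {X ι : Type u}
    [TopologicalSpace X] [PolishSpace X] (hι : #ι < 𝔠) {C : ι → FinitaryRelation X}
    (hC : ∀ i, IsClosed (C i).carrier) (hCd : ∀ i, Dense (C i).carrierᶜ) :
    ∃ F : Set X, F.Countable ∧ Dense F ∧ IsFreeFor C F := by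
  -- Over an empty `X`, positive arity rules out even the empty tuple.
  rcases isEmpty_or_nonempty X with hX | hX
  · refine ⟨∅, countable_empty, fun x => hX.elim x, fun i x hx => ?_⟩
    exact hX.elim (x ⟨0, (C i).one_le_arity⟩)
  let J := Σ i : ι, Fin (C i).arity ↪ ℕ
  -- Conditions on a sequence: it enters each basic open set, and no choice of distinct indices
  -- gives a tuple in a relation.
  let V : countableBasis X ⊕ J → Set (ℕ → X) :=
    Sum.elim (fun O => {x | ∃ n, x n ∈ (O : Set X)}) fun j => {x | x ∘ j.2 ∉ (C j.1).carrier}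
  have hJ : #J < 𝔠 := by
    have (i : ι) : Countable (Fin (C i).arity ↪ ℕ) :=
      (DFunLike.coe_injective (F := Fin (C i).arity ↪ ℕ)).countable
    refine (mk_sigma _).trans_lt ((sum_le_sum _ (fun _ => ℵ₀) fun i => mk_le_aleph0).trans_lt ?_)
    simpa using mul_lt_of_lt aleph0_le_continuum hι aleph0_lt_continuum
  obtain ⟨x, hx⟩ := hMA.exists_mem_of_dense_open V
    (by
      rw [mk_sum]
      refine add_lt_of_lt aleph0_le_continuum ?_ (by simpa using hJ)
      simpa using (countable_countableBasis X).le_aleph0.trans_lt aleph0_lt_continuum)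
    (by
      rintro (O | ⟨i, e⟩)
      · simp only [V, Sum.elim_inl, ofPred_exists]
        exact isOpen_iUnion fun n => (isOpen_of_mem_countableBasis O.2).preimage (continuous_apply n)
      · exact (hC i).isOpen_compl.preimage (by fun_prop : Continuous fun x : ℕ → X => x ∘ e))
    (by
      rintro (O | ⟨i, e⟩) y
      · obtain ⟨u, hu⟩ := nonempty_of_mem_countableBasis O.2
        -- Changing one late coordinate moves `y` arbitrarily little.
        have hlim : Filter.Tendsto (fun n => Function.update y n u) Filter.atTop (𝓝 y) := by
          rw [tendsto_pi_nhds]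
          intro m
          refine tendsto_const_nhds.congr' ?_
          filter_upwards [Filter.eventually_gt_atTop m] with n hn
          rw [Function.update_of_ne hn.ne]
        exact mem_closure_of_tendsto hlim (Filter.Eventually.of_forall fun n => ⟨n, by simpa⟩)
      · rw [mem_closure_iff]
        intro O hO hy
        -- Only the coordinates in the range of `e` are moved, which reduces density to that of the
        -- complement in the finite power.
        let L : (Fin (C i).arity → X) → ℕ → X := fun z => Function.extend e z y
        have hL : Continuous L := by
          refine continuous_pi fun n => ?_
          by_cases hn : ∃ k, e k = n
          · obtain ⟨k, rfl⟩ := hn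
            simpa only [L, e.injective.extend_apply] using continuous_apply k
          · simpa only [L, Function.extend_apply' _ _ _ hn] using continuous_const
        have hLy : L (y ∘ e) = y := by
          funext n
          by_cases hn : ∃ k, e k = n
          · obtain ⟨k, rfl⟩ := hn
            simp only [L, e.injective.extend_apply, Function.comp]
          · simp only [L, Function.extend_apply' _ _ _ hn]
        obtain ⟨z, hzO, hzC⟩ := mem_closure_iff.1 (hCd i (y ∘ e)) _ (hO.preimage hL)
          (by simpa only [mem_preimage, hLy] using hy)
        refine ⟨L z, hzO, ?_⟩
        change Function.extend e z y ∘ e ∉ (C i).carrier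
        rwa [Function.extend_comp e.injective])
  refine ⟨range x, countable_range x, ?_, ?_⟩
  · refine (isBasis_countableBasis X).dense_iff.2 fun O hO _ => ?_
    obtain ⟨n, hn⟩ := hx (Sum.inl ⟨O, hO⟩)
    exact ⟨x n, hn, n, rfl⟩
  · intro i z hz hinj
    choose e he using hz
    have he' : Function.Injective e := fun k l h => hinj (by rw [← he k, ← he l, h])
    have := hx (Sum.inr ⟨i, e, he'⟩)
    rwa [show z = x ∘ e from funext fun k => (he k).symm]

/-! ### Testing complete Baireness on countable crowded sets -/

/-- A subspace `F` is completely Baire if every sequence of open sets that are dense on a countable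
crowded subset `K` of `F` has a common point in `F` and in the closure of `K`. -/
theorem isCompletelyBaire_of_crowded {X : Type*} [TopologicalSpace X] [T1Space X]
    [SecondCountableTopology X] {F : Set X}
    (h : ∀ (K : Set X) (U : ℕ → Set X), K ⊆ F → K.Countable → K.Nonempty →
      (∀ p, K ⊆ closure (K \ {p})) → (∀ n, IsOpen (U n)) → (∀ n, K ⊆ closure (U n ∩ K)) →
      (F ∩ (closure K ∩ ⋂ n, U n)).Nonempty) :
    IsCompletelyBaire F := by
  intro A hA
  let e : A → X := fun a => ((a : F) : X)
  have he : IsEmbedding e := IsEmbedding.subtypeVal.comp IsEmbedding.subtypeVal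
  refine ⟨fun f hfo hfd y => mem_closure_iff.2 fun O' hO' hy => ?_⟩
  obtain ⟨O, hO, rfl⟩ := he.isOpen_iff.1 hO'
  choose U hU hUf using fun n => he.isOpen_iff.1 (hfo n)
  -- An isolated point of `A` belongs to every dense set. Without one in `O`, the trace on `O` of a
  -- countable dense subset of `A` is crowded.
  by_cases hiso : ∃ p : A, e p ∈ O ∧ IsOpen {p}
  · obtain ⟨p, hpO, hp⟩ := hiso
    refine ⟨p, hpO, mem_iInter.2 fun n => ?_⟩
    obtain ⟨q, rfl, hq⟩ := (hfd n).inter_open_nonempty _ hp (singleton_nonempty p)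
    exact hq
  push Not at hiso
  obtain ⟨D, hDc, hD⟩ := exists_countable_dense A
  have hmeet : ∀ B : Set A, IsOpen B → B.Nonempty → B ⊆ e ⁻¹' O →
      ∃ d ∈ B, e d ∈ e '' D ∩ O := fun B hB hne hBO => by
    obtain ⟨d, hdB, hdD⟩ := hD.inter_open_nonempty B hB hne
    exact ⟨d, hdB, mem_image_of_mem e hdD, hBO hdB⟩
  -- The open sets are cut down to `O` because `closure K` may leave `O`.
  obtain ⟨x, hxF, hxK, hxU⟩ := h (e '' D ∩ O) (fun n => U n ∩ O)
    (by rintro _ ⟨⟨d, -, rfl⟩, -⟩; exact d.1.2)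
    ((hDc.image e).mono inter_subset_left)
    (by
      obtain ⟨d, -, hd⟩ := hmeet _ hO' ⟨y, hy⟩ subset_rfl
      exact ⟨_, hd⟩)
    (by
      rintro p _ ⟨⟨d, -, rfl⟩, hdO⟩
      refine mem_closure_iff.2 fun V hV hdV => ?_
      have hopen : IsOpen (e ⁻¹' (V ∩ O)) := (hV.inter hO).preimage he.continuous
      obtain ⟨d', hd', hne⟩ : ∃ d' ∈ e ⁻¹' (V ∩ O), e d' ≠ p := by
        by_contra! hall
        refine hiso d hdO ?_
        convert hopen
        refine Subset.antisymm (by simpa using ⟨hdV, hdO⟩) fun d' hd' => he.injective ?_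
        rw [hall d' hd', hall d ⟨hdV, hdO⟩]
      obtain ⟨d₁, ⟨⟨h₁V, -⟩, h₁p⟩, h₁K⟩ := hmeet (e ⁻¹' (V ∩ O) ∩ e ⁻¹' {p}ᶜ)
        (hopen.inter (isOpen_compl_singleton.preimage he.continuous)) ⟨d', hd', hne⟩
        fun _ hd => hd.1.2
      exact ⟨e d₁, h₁V, h₁K, h₁p⟩)
    (fun n => (hU n).inter hO)
    (by
      rintro n _ ⟨⟨d, -, rfl⟩, hdO⟩
      refine mem_closure_iff.2 fun V hV hdV => ?_
      have hopen : IsOpen (e ⁻¹' (V ∩ O)) := (hV.inter hO).preimage he.continuous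
      obtain ⟨d₁, ⟨⟨h₁V, h₁O⟩, h₁f⟩, h₁K⟩ := hmeet (e ⁻¹' (V ∩ O) ∩ f n)
        (hopen.inter (hfo n)) ((hfd n).inter_open_nonempty _ hopen ⟨d, hdV, hdO⟩)
        fun _ hd => hd.1.2
      rw [← hUf n] at h₁f
      exact ⟨e d₁, h₁V, ⟨h₁f, h₁O⟩, h₁K⟩)
  obtain ⟨Z, hZ, rfl⟩ := isClosed_induced_iff.1 hA
  have hxZ : x ∈ Z := closure_minimal
    (by rintro _ ⟨⟨d, -, rfl⟩, -⟩; exact d.2) hZ hxK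
  have hxU' := mem_iInter.1 hxU
  refine ⟨⟨⟨x, hxF⟩, hxZ⟩, (hxU' 0).2, mem_iInter.2 fun n => ?_⟩
  rw [← hUf n]
  exact (hxU' n).1

/-! ### Counting the tasks and conclusion -/

/-- An open set is determined by the basic open sets it contains. -/
theorem mk_opens_le_continuum (X : Type u) [TopologicalSpace X] [SecondCountableTopology X] :
    #(Opens X) ≤ 𝔠 := by
  have hinj : Function.Injective
      fun U : Opens X => {b : countableBasis X | (b : Set X) ⊆ U} := by
    intro U V h
    ext x
    have key : ∀ {U V : Opens X}, {b : countableBasis X | (b : Set X) ⊆ U} =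
        {b : countableBasis X | (b : Set X) ⊆ V} → x ∈ U → x ∈ V := fun {U V} h hx => by
      obtain ⟨b, hb, hxb, hbU⟩ := (isBasis_countableBasis X).exists_subset_of_mem_open hx U.2
      exact (Set.ext_iff.1 h ⟨b, hb⟩).1 hbU hxb
    exact ⟨key h, key h.symm⟩
  refine (mk_le_of_injective hinj).trans ?_
  rw [mk_set, ← two_power_aleph0]
  exact power_le_power_left two_ne_zero (countable_countableBasis X).le_aleph0

theorem mk_le_continuum_of_secondCountable (X : Type u) [TopologicalSpace X] [T1Space X]
    [SecondCountableTopology X] : #X ≤ 𝔠 := by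
  refine (mk_le_of_injective (f := fun x : X => (⟨{x}ᶜ, isOpen_compl_singleton⟩ : Opens X))
    fun x y h => ?_).trans (mk_opens_le_continuum X)
  simpa using h

theorem mk_seq_le_continuum {X : Type u} (hX : #X ≤ 𝔠) : #(ℕ → X) ≤ 𝔠 := by
  simpa using power_le_power_right (c := ℵ₀) hX

/-- A task is a sequence enumerating a crowded set, paired with a sequence of open sets dense on it.
Nowhere density of the relations serves only to find `F₀`; the extensions use closedness alone. -/
theorem MACountable.exists_dense_isCompletelyBaire_isFreeFor (hMA : MACountable) {X ι : Type u}
    [TopologicalSpace X] [PolishSpace X] (hι : #ι < 𝔠) {C : ι → FinitaryRelation X}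
    (hC : ∀ i, IsClosed (C i).carrier) (hCd : ∀ i, Dense (C i).carrierᶜ) :
    ∃ F : Set X, Dense F ∧ IsCompletelyBaire F ∧ IsFreeFor C F := by
  obtain ⟨F₀, hc₀, hd₀, h₀⟩ := hMA.exists_countable_dense_isFreeFor hι hC hCd
  let W := {w : (ℕ → X) × (ℕ → Opens X) // (∀ p, range w.1 ⊆ closure (range w.1 \ {p})) ∧
    ∀ n, range w.1 ⊆ closure ((w.2 n : Set X) ∩ range w.1)}
  have hW : #W ≤ 𝔠 := by
    refine (mk_subtype_le _).trans ?_
    rw [mk_prod, lift_id, lift_id, ← continuum_mul_self]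
    exact mul_le_mul' (mk_seq_le_continuum (mk_le_continuum_of_secondCountable X))
      (mk_seq_le_continuum (mk_opens_le_continuum X))
  obtain ⟨F, hF₀, hF, hT⟩ := exists_free_superset hW (isFreeFor_iff_finite C)
    (fun w => range w.1.1) (fun w => closure (range w.1.1) ∩ ⋂ n, (w.1.2 n : Set X))
    (fun w => countable_range _)
    (fun w F hF hFc hKF => hMA.exists_isFreeFor_insert hι hC hF hFc hKF (range_nonempty _) w.2.1
      (fun n => (w.1.2 n).2) w.2.2) h₀ hc₀
  refine ⟨F, hd₀.mono hF₀, isCompletelyBaire_of_crowded ?_, hF⟩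
  intro K U hKF hKc hKn hcr hU hUK
  obtain ⟨k, rfl⟩ := hKc.exists_eq_range hKn
  exact hT ⟨(k, fun n => ⟨U n, hU n⟩), hcr, hUK⟩ hKF

/-- The closures of the nowhere dense pieces of all the relations still number fewer than `𝔠`, and a
set free for them is free for the original relations. -/
theorem theorem7p2 (hMA : MACountable) {X : Type*} [TopologicalSpace X] [PolishSpace X]
    (𝓡 : Set (FinitaryRelation X)) (hmeager : ∀ R ∈ 𝓡, R.IsMeager)
    (hcard : Cardinal.mk 𝓡 < Cardinal.continuum) :
    ∃ F : Set X, Dense F ∧ IsCompletelyBaire F ∧ ∀ R ∈ 𝓡, R.IsFree F := by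
  choose S hSn hSc hS using fun R : 𝓡 =>
    isMeagre_iff_countable_union_isNowhereDense.1 (hmeager R R.2)
  have hι : #(Σ R : 𝓡, S R) < 𝔠 := by
    refine (mk_sigma _).trans_lt
      ((sum_le_sum _ (fun _ => ℵ₀) fun R => (hSc R).le_aleph0).trans_lt ?_)
    simpa using mul_lt_of_lt aleph0_le_continuum hcard aleph0_lt_continuum
  let C : (Σ R : 𝓡, S R) → FinitaryRelation X := fun j =>
    ⟨j.1.1.arity, j.1.1.one_le_arity, closure (j.2 : Set (Fin j.1.1.arity → X))⟩
  obtain ⟨F, hd, hcb, hF⟩ := hMA.exists_dense_isCompletelyBaire_isFreeFor (C := C) hι (fun _ => isClosed_closure)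
    (fun j => interior_eq_empty_iff_dense_compl.1 (hSn j.1 j.2 j.2.2))
  refine ⟨F, hd, hcb, fun R hR x hx hinj hxR => ?_⟩
  obtain ⟨t, ht, hxt⟩ := hS ⟨R, hR⟩ hxR
  exact hF ⟨⟨R, hR⟩, t, ht⟩ x hx hinj (subset_closure hxt)
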